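/- Let $A$ be a finite nonempty set and let $\mathcal{G}=(A,E)$ be a graph, where $E\subseteq\{\{a,b\}: a,b\in A\}$ contains the loop $\{a\}$ for every $a\in A$. Call $\mathcal G$ connected if any two vertices $a,b\in A$ are joined by a finite sequence $a=v_1,\dots,v_n=b$ in $A$ with $\{v_k,v_{k+1}\}\in E$ for all $1\le k<n$. Let $N(A)=A^{\mathbb N}$, $\mathbb N=\{1,2,\dots\}$, carry the metric $d(x,y)=1/\min\{n: x_n\ne y_n\}$ for $x\neq y$ (and $d(x,x)=0$). Let $x\sim y$ mean that $x=y$, or that $x=s\,a\,bbb\cdots$ and $y=s\,b\,aaa\cdots$ for some finite (possibly empty) word $s$ over $A$ and some $a,b\in A$ with $\{a,b\}\in E$; this is an equivalence relation on $N(A)$. Let $J_A^{\mathcal G}=N(A)/{\sim}$ with the quotient topology. Fix $z\in A$, put $A'=A\setminus\{z\}$, and for $a,a',b\in A$ let $c_{aa'b}=0$ if $a'\neq b$, $c_{aa'b}=\tfrac12$ if $a'=b$ and $\{a,a'\}\in E$, and $c_{aa'b}=\tfrac13$ if $a'=b$ and $\{a,a'\}\notin E$. Let $\omega_{\mathcal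 G}^A\subseteq \ell^2(A')$ be the set of all points $\bigl(\sum_{i=1}^\infty\prod_{j=1}^i c_{x_jx_ib}\bigr)_{b\in A'}$ with $x\in N(A)$, with the subspace topology. Call a topological space arcwise connected if for any two distinct points $p,q$ of it there is a homeomorphic embedding $h$ of $[0,1]$ into it with $h(0)=p$ and $h(1)=q$. Then the following statements are equivalent: 1. the graph $\mathcal G$ is connected; 2. the space $J_A^{\mathcal G}$ is connected and locally connected; 3. the space $\omega_{\mathcal G}^A$ is connected and locally connected; 4. the space $J_A^{\mathcal G}$ is arcwise connected; 5. the space $\omega_{\mathcal G}^A$ is arcwise connected. -/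

import Mathlib

namespace GraphLipscomb

/-- A graph on the vertex set `V`: a set of unordered pairs of vertices that contains
the loop `{v}` of every vertex `v`. -/
structure LoopGraph (V : Type*) where
  edges : Set (Sym2 V)
  loop_mem : ∀ v : V, s(v, v) ∈ edges

/-- Any two vertices are joined by a finite walk along edges. -/
def LoopGraph.Connected {V : Type*} (G : LoopGraph V) : Prop :=
  ∀ v u : V, ∃ (n : ℕ) (w : ℕ → V), w 0 = v ∧ w n = u ∧ ∀ k < n, s(w k, w (k + 1)) ∈ G.edges

/-- The set of infinite words over `A`; the letters are indexed from `0`. -/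
def BaireSpace (A : Type*) : Type _ := ℕ → A

open Classical in
/-- The metric `d x y = 1 / n`, where the words first differ at their `n`-th letter
(`PiNat.firstDiff` counts from `0`, hence the `+ 1`). The topology is the one of this metric. -/
noncomputable instance BaireSpace.instMetricSpace (A : Type*) : MetricSpace (BaireSpace A) where
  dist x y := if x = y then 0 else 1 / ((PiNat.firstDiff (E := fun _ : ℕ => A) x y : ℝ) + 1)
  dist_self x := by simp
  dist_comm x y := by
    simp only [PiNat.firstDiff_comm (E := fun _ : ℕ => A) x y, eq_comm]
  dist_triangle x y z := by
    have pos : ∀ n : ℕ, (0 : ℝ) < 1 / ((n : ℝ) + 1) := fun n => by positivity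
    have anti : ∀ m n : ℕ, m ≤ n → 1 / ((n : ℝ) + 1) ≤ 1 / ((m : ℝ) + 1) := fun m n h => by
      gcongr
    by_cases hxz : x = z
    · simp only [hxz, if_true]
      split_ifs <;> positivity
    by_cases hxy : x = y
    · subst hxy; simp
    by_cases hyz : y = z
    · subst hyz; simp
    simp only [hxz, hxy, hyz, if_false]
    have h := PiNat.min_firstDiff_le (E := fun _ : ℕ => A) x y z hxz
    rcases min_le_iff.1 h with h | h
    · have := anti _ _ h
      have := pos (PiNat.firstDiff (E := fun _ : ℕ => A) y z)
      linarith
    · have := anti _ _ h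
      have := pos (PiNat.firstDiff (E := fun _ : ℕ => A) x y)
      linarith
  eq_of_dist_eq_zero {x y} h := by
    by_contra hxy
    simp only [hxy, if_false] at h
    have : (0 : ℝ) < 1 / ((PiNat.firstDiff (E := fun _ : ℕ => A) x y : ℝ) + 1) := by positivity
    linarith

/-- The infinite word `s a b b b ⋯`, for a finite word `s` and letters `a`, `b`. -/
def tailWord {A : Type*} (s : List A) (a b : A) : BaireSpace A :=
  fun n => (s ++ [a]).getD n b

theorem tailWord_lt {A : Type*} (s : List A) (a b : A) {n : ℕ} (h : n < s.length) :
    tailWord s a b n = s[n] := by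
  simp [tailWord, List.getD, List.getElem?_append_left h, List.getElem?_eq_getElem h]

theorem tailWord_length {A : Type*} (s : List A) (a b : A) : tailWord s a b s.length = a := by
  simp [tailWord, List.getD]

theorem tailWord_gt {A : Type*} (s : List A) (a b : A) {n : ℕ} (h : s.length < n) :
    tailWord s a b n = b := by
  have : (s ++ [a]).length ≤ n := by simp; omega
  simp only [tailWord, List.getD, List.getElem?_eq_none this, Option.getD_none]

theorem tailWord_self {A : Type*} (s : List A) (a : A) {n : ℕ} (h : s.length ≤ n) :
    tailWord s a a n = a := by
  rcases h.eq_or_lt with rfl | h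
  · exact tailWord_length s a a
  · exact tailWord_gt s a a h

theorem tailWord_inj {A : Type*} {s t : List A} {a b c d : A} (hab : a ≠ b) (hcd : c ≠ d)
    (h : tailWord s a b = tailWord t c d) : s = t ∧ a = c ∧ b = d := by
  have hbd : b = d := by
    have := congrFun h (s.length + t.length + 1)
    rwa [tailWord_gt _ _ _ (by omega), tailWord_gt _ _ _ (by omega)] at this
  subst hbd
  have hl : s.length = t.length := by
    rcases lt_trichotomy s.length t.length with hl | hl | hl
    · have := congrFun h t.length
      rw [tailWord_gt _ _ _ hl, tailWord_length] at this
      exact absurd this.symm hcd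
    · exact hl
    · have := congrFun h s.length
      rw [tailWord_gt _ _ _ hl, tailWord_length] at this
      exact absurd this hab
  refine ⟨List.ext_getElem hl fun n h1 h2 => ?_, ?_, rfl⟩
  · have := congrFun h n
    rwa [tailWord_lt _ _ _ h1, tailWord_lt _ _ _ h2] at this
  · have := congrFun h s.length
    rw [tailWord_length, hl, tailWord_length] at this
    exact this

/-- The relation `x ∼ y`: either `x = y`, or `x = s a b b b ⋯` and `y = s b a a a ⋯`
with `{a, b}` an edge. -/
def LoopGraph.Rel {A : Type*} (G : LoopGraph A) (x y : BaireSpace A) : Prop :=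
  x = y ∨ ∃ (s : List A) (a b : A),
    s(a, b) ∈ G.edges ∧ x = tailWord s a b ∧ y = tailWord s b a

theorem LoopGraph.rel_trans {A : Type*} (G : LoopGraph A) {x y z : BaireSpace A}
    (hxy : G.Rel x y) (hyz : G.Rel y z) : G.Rel x z := by
  rcases hxy with rfl | ⟨s, a, b, hab, hx, hy⟩
  · exact hyz
  rcases hyz with rfl | ⟨t, c, d, hcd, hy', hz⟩
  · exact Or.inr ⟨s, a, b, hab, hx, hy⟩
  by_cases h1 : a = b
  · subst h1
    exact Or.inr ⟨t, c, d, hcd, (hx.trans hy.symm).trans hy', hz⟩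
  by_cases h2 : c = d
  · subst h2
    exact Or.inr ⟨s, a, b, hab, hx, (hz.trans hy'.symm).trans hy⟩
  obtain ⟨rfl, rfl, rfl⟩ := tailWord_inj (Ne.symm h1) h2 (hy.symm.trans hy')
  exact Or.inl (hx.trans hz.symm)

/-- The equivalence relation `∼` on the Baire space. -/
def LoopGraph.setoid {A : Type*} (G : LoopGraph A) : Setoid (BaireSpace A) where
  r := G.Rel
  iseqv :=
    { refl := fun _ => Or.inl rfl
      symm := by
        rintro x y (rfl | ⟨s, a, b, hab, hx, hy⟩)
        · exact Or.inl rfl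
        · exact Or.inr ⟨s, b, a, Sym2.eq_swap ▸ hab, hy, hx⟩
      trans := G.rel_trans }

/-- The graph Lipscomb space: the quotient of the Baire space by `∼`, with the quotient
topology. -/
abbrev LoopGraph.Lipscomb {A : Type*} (G : LoopGraph A) : Type _ := Quotient G.setoid

open Classical in
/-- The coefficients `c_{a a' b}`. -/
noncomputable def LoopGraph.coeff {A : Type*} (G : LoopGraph A) (a a' b : A) : ℝ :=
  if a' = b then (if s(a, a') ∈ G.edges then 1 / 2 else 1 / 3) else 0

/-- The `b`-th coordinate of the image of an infinite word:
`α_b(x) = ∑_i ∏_{j ≤ i} c_{x_j x_i b}`. -/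
noncomputable def LoopGraph.alpha {A : Type*} (G : LoopGraph A) (b : A) (x : BaireSpace A) : ℝ :=
  ∑' i : ℕ, ∏ j ∈ Finset.range (i + 1), G.coeff (x j) (x i) b

/-- The series that defines `α_b(x)` converges. -/
theorem LoopGraph.summable_alpha {A : Type*} (G : LoopGraph A) (b : A) (x : BaireSpace A) :
    Summable fun i : ℕ => ∏ j ∈ Finset.range (i + 1), G.coeff (x j) (x i) b := by
  have h0 : ∀ a a', 0 ≤ G.coeff a a' b := fun a a' => by
    unfold LoopGraph.coeff; split_ifs <;> norm_num
  have h1 : ∀ a a', G.coeff a a' b ≤ 1 / 2 := fun a a' => by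
    unfold LoopGraph.coeff; split_ifs <;> norm_num
  have hg : Summable fun i : ℕ => ((1 : ℝ) / 2) ^ (i + 1) :=
    (summable_nat_add_iff 1).2 summable_geometric_two
  refine Summable.of_nonneg_of_le (fun i => Finset.prod_nonneg fun j _ => h0 _ _) (fun i => ?_) hg
  calc _ ≤ ∏ _j ∈ Finset.range (i + 1), (1 : ℝ) / 2 :=
        Finset.prod_le_prod (fun j _ => h0 _ _) (fun j _ => h1 _ _)
    _ = _ := by simp

/-- The map `p : N(A) → ℓ²(A ∖ {z})`, `p(x) = (α_b(x))_b`, for a finite alphabet `A`. -/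
noncomputable def LoopGraph.embed {A : Type*} [Finite A] (G : LoopGraph A) (z : A)
    (x : BaireSpace A) : lp (fun _ : {b : A // b ≠ z} => ℝ) 2 :=
  ⟨fun b => G.alpha b x, Memℓp.all _⟩

/-- The embedded version `ω = p(N(A))` of the graph Lipscomb space, a subset of `ℓ²(A ∖ {z})`
(with the subspace topology). -/
def LoopGraph.omega {A : Type*} [Finite A] (G : LoopGraph A) (z : A) :
    Set (lp (fun _ : {b : A // b ≠ z} => ℝ) 2) :=
  Set.range (G.embed z)

/-- Any two distinct points are the end points of an arc, that is, of a homeomorphic copy of the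
unit interval. -/
def ArcwiseConnected (X : Type*) [TopologicalSpace X] : Prop :=
  ∀ x y : X, x ≠ y → ∃ h : unitInterval → X, Topology.IsEmbedding h ∧ h 0 = x ∧ h 1 = y

end GraphLipscomb

/-! Prepending a letter acts on each coordinate `alpha b` as an affine contraction
(`alpha_wordCons_self`, `alpha_wordCons_of_ne`). Comparing two words at their first difference shows
that the coordinates with `b ≠ z` agree exactly when the words are related (`rel_iff_forall_alpha`).
So the coordinate map induces a continuous injection of the compact quotient into `ℓ²`. This gives
`lipscombHomeomorph`, and statements 3 and 5 become statements 2 and 4.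

If the quotient is connected, so is the graph: gluing changes the first letter of a word only along
an edge, so the words whose first letter lies in a given component form a saturated clopen set
(`connected_of_preconnectedSpace`).

Conversely, let the graph be connected. The quotient is self-similar: it is the union of copies of
itself, one cell for each letter, and distinct cells meet only along an edge and then in one point
(`of_lipscombCons_eq`). Two distinct points are joined by a chain of cells along an induced path.
Such a chain splits into two chains with exactly one common point (`exists_split`), and repeated
splitting shrinks to points. The binary words of choices are then identified exactly as binary
expansions of numbers in the unit interval, which yields an arc (`ArcSystem.exists_arc`). Hence the
quotient is connected, and so are its cells; the finite unions of the cells of a given level around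
a point are small connected neighbourhoods (`locallyConnectedSpace_lipscomb`). -/

open Topology Filter

namespace GraphLipscomb

variable {A : Type*}

/-! ### Infinite words -/

/-- The infinite word `a x₀ x₁ ⋯`. -/
def wordCons (a : A) (x : BaireSpace A) : BaireSpace A
  | 0 => a
  | n + 1 => x n

/-- The infinite word `s x₀ x₁ ⋯` for a finite word `s`. -/
def wordAppend : List A → BaireSpace A → BaireSpace A
  | [], x => x
  | a :: s, x => wordCons a (wordAppend s x)

/-- The constant word `a a a ⋯`. -/
def wordConst (a : A) : BaireSpace A := fun _ => a

theorem exists_eq_wordCons (x : BaireSpace A) : ∃ a y, x = wordCons a y :=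
  ⟨x 0, fun n => x (n + 1), by funext n; cases n <;> rfl⟩

theorem wordConst_eq (a : A) : wordConst a = wordCons a (wordConst a) := by
  funext n; cases n <;> rfl

theorem wordAppend_append (s t : List A) (x : BaireSpace A) :
    wordAppend (s ++ t) x = wordAppend s (wordAppend t x) := by
  induction s with
  | nil => rfl
  | cons a s ih => simp [wordAppend, ih]

theorem tailWord_cons (c : A) (s : List A) (a b : A) :
    tailWord (c :: s) a b = wordCons c (tailWord s a b) := by
  funext n; cases n <;> rfl

theorem tailWord_nil (a b : A) : tailWord [] a b = wordCons a (wordConst b) := by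
  funext n; cases n <;> rfl

theorem tailWord_eq (s : List A) (a b : A) :
    tailWord s a b = wordAppend s (wordCons a (wordConst b)) := by
  induction s with
  | nil => exact tailWord_nil a b
  | cons c s ih => rw [tailWord_cons, ih]; rfl

theorem exists_eq_wordAppend (n : ℕ) (x : BaireSpace A) :
    ∃ s y, s.length = n ∧ x = wordAppend s y := by
  induction n generalizing x with
  | zero => exact ⟨[], x, rfl, rfl⟩
  | succ n ih =>
    obtain ⟨a, y, rfl⟩ := exists_eq_wordCons x
    obtain ⟨s, y, rfl, rfl⟩ := ih y
    exact ⟨a :: s, y, rfl, rfl⟩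

/-- Reduces every comparison of two words to words with different first letters. -/
theorem exists_common_prefix {x y : BaireSpace A} (h : x ≠ y) :
    ∃ s a b x' y', a ≠ b ∧ x = wordAppend s (wordCons a x') ∧
      y = wordAppend s (wordCons b y') := by
  obtain ⟨n, hn⟩ := Function.ne_iff.1 h
  induction n generalizing x y with
  | zero =>
    obtain ⟨a, x, rfl⟩ := exists_eq_wordCons x
    obtain ⟨b, y, rfl⟩ := exists_eq_wordCons y
    exact ⟨[], a, b, x, y, hn, rfl, rfl⟩
  | succ n ih =>
    obtain ⟨a, x, rfl⟩ := exists_eq_wordCons x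
    obtain ⟨b, y, rfl⟩ := exists_eq_wordCons y
    by_cases hab : a = b
    · subst hab
      obtain ⟨s, c, d, x', y', hcd, rfl, rfl⟩ :=
        ih (x := x) (y := y) (fun h' => hn (congrFun h' n)) hn
      exact ⟨a :: s, c, d, x', y', hcd, rfl, rfl⟩
    · exact ⟨[], a, b, x, y, hab, rfl, rfl⟩

/-! ### Topology of the space of words: cylinders and compactness. -/

open Classical in
theorem BaireSpace.nhds_hasBasis (x : BaireSpace A) :
    (𝓝 x).HasBasis (fun _ : ℕ => True) (fun n => {y : BaireSpace A | ∀ i < n, y i = x i}) := by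
  refine Metric.nhds_basis_ball.to_hasBasis (fun ε hε => ?_) (fun n _ => ?_)
  · obtain ⟨n, hn⟩ := exists_nat_one_div_lt hε
    refine ⟨n, trivial, fun y hy => ?_⟩
    change (if y = x then (0 : ℝ) else _) < ε
    split_ifs with hxy
    · exact hε
    · refine lt_of_le_of_lt ?_ hn
      have : n ≤ PiNat.firstDiff (E := fun _ : ℕ => A) y x := by
        by_contra hlt
        exact PiNat.apply_firstDiff_ne (E := fun _ : ℕ => A) hxy (hy _ (not_le.1 hlt))
      gcongr
  · refine ⟨1 / ((n : ℝ) + 1), by positivity, fun y hy i hi => ?_⟩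
    change (if y = x then (0 : ℝ) else _) < _ at hy
    split_ifs at hy with hxy
    · rw [hxy]
    · refine PiNat.apply_eq_of_lt_firstDiff (E := fun _ : ℕ => A) (hi.trans ?_)
      have := (one_div_lt_one_div (by positivity) (by positivity)).1 hy
      have h2 : (n : ℝ) < PiNat.firstDiff (E := fun _ : ℕ => A) y x := by linarith
      exact_mod_cast h2

theorem BaireSpace.continuous_of_forall {X : Type*} [TopologicalSpace X] {f : BaireSpace A → X}
    (h : ∀ x, ∀ U ∈ 𝓝 (f x), ∃ n : ℕ, ∀ y : BaireSpace A, (∀ i < n, y i = x i) → f y ∈ U) :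
    Continuous f := by
  refine continuous_iff_continuousAt.2 fun x U hU => ?_
  obtain ⟨n, hn⟩ := h x U hU
  exact (BaireSpace.nhds_hasBasis x).mem_iff.2 ⟨n, trivial, fun y hy => hn y hy⟩

theorem BaireSpace.continuous_of_eq {X : Type*} [TopologicalSpace X] {f : BaireSpace A → X}
    (n : ℕ) (h : ∀ x y : BaireSpace A, (∀ i < n, y i = x i) → f y = f x) : Continuous f :=
  BaireSpace.continuous_of_forall fun x U hU => ⟨n, fun y hy => by
    rw [h x y hy]; exact mem_of_mem_nhds hU⟩

theorem continuous_wordCons (a : A) : Continuous (wordCons a) := by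
  refine BaireSpace.continuous_of_forall fun x U hU => ?_
  obtain ⟨n, -, hn⟩ := (BaireSpace.nhds_hasBasis _).mem_iff.1 hU
  refine ⟨n, fun y hy => hn fun i hi => ?_⟩
  cases i with
  | zero => rfl
  | succ i => exact hy i (by omega)

/-- Tychonoff for the product of finite discrete spaces, carried over by the identity map, which is
continuous into the metric topology. -/
instance BaireSpace.instCompactSpace [Finite A] : CompactSpace (BaireSpace A) := by
  let : TopologicalSpace A := ⊥
  have : DiscreteTopology A := ⟨rfl⟩
  let f : (ℕ → A) → BaireSpace A := fun x => x
  have hc : Continuous f := by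
    refine continuous_iff_continuousAt.2 fun x U hU => ?_
    obtain ⟨n, -, hn⟩ := (BaireSpace.nhds_hasBasis (f x)).mem_iff.1 hU
    have hopen : IsOpen (⋂ i ∈ Finset.range n, {y : ℕ → A | y i = x i}) :=
      isOpen_biInter_finset fun i _ =>
        (isOpen_discrete {x i}).preimage (continuous_apply (A := fun _ : ℕ => A) i)
    refine mem_map.2 (mem_of_superset (hopen.mem_nhds (by simp)) fun y hy => hn fun i hi => ?_)
    simpa using Set.mem_iInter₂.1 hy i (by simpa using hi)
  have hs : Function.Surjective f := fun x => ⟨x, rfl⟩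
  exact hs.compactSpace hc

/-! ### The coordinate functions -/

namespace LoopGraph

variable (G : LoopGraph A)

theorem coeff_self_nonneg (a b : A) : 0 ≤ G.coeff a b b := by
  unfold coeff; split_ifs <;> norm_num

theorem coeff_self_le (a b : A) : G.coeff a b b ≤ 1 / 2 := by
  unfold coeff; split_ifs <;> norm_num

theorem coeff_of_edge {a b : A} (h : s(a, b) ∈ G.edges) : G.coeff a b b = 1 / 2 := by
  simp [coeff, h]

theorem coeff_of_not_edge {a b : A} (h : s(a, b) ∉ G.edges) : G.coeff a b b = 1 / 3 := by
  simp [coeff, h]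

theorem coeff_self_pos (a b : A) : 0 < G.coeff a b b := by
  unfold coeff; split_ifs <;> simp_all

theorem coeff_of_ne {a a' b : A} (h : a' ≠ b) : G.coeff a a' b = 0 := by
  simp [coeff, h]

theorem coeff_nonneg (a a' b : A) : 0 ≤ G.coeff a a' b := by
  unfold coeff; split_ifs <;> norm_num

theorem coeff_le (a a' b : A) : G.coeff a a' b ≤ 1 / 2 := by
  unfold coeff; split_ifs <;> norm_num

theorem prod_coeff_nonneg (b : A) (x : BaireSpace A) (i : ℕ) :
    0 ≤ ∏ j ∈ Finset.range (i + 1), G.coeff (x j) (x i) b :=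
  Finset.prod_nonneg fun _ _ => G.coeff_nonneg _ _ _

theorem prod_coeff_le (b : A) (x : BaireSpace A) (i : ℕ) :
    ∏ j ∈ Finset.range (i + 1), G.coeff (x j) (x i) b ≤ 1 / 2 / 2 ^ i := by
  calc _ ≤ ∏ _j ∈ Finset.range (i + 1), (1 : ℝ) / 2 :=
        Finset.prod_le_prod (fun j _ => G.coeff_nonneg _ _ _) (fun j _ => G.coeff_le _ _ _)
    _ = _ := by rw [Finset.prod_const, Finset.card_range, pow_succ, div_pow, one_pow]; ring

theorem alpha_nonneg (b : A) (x : BaireSpace A) : 0 ≤ G.alpha b x :=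
  tsum_nonneg fun i => G.prod_coeff_nonneg b x i

theorem alpha_le_one (b : A) (x : BaireSpace A) : G.alpha b x ≤ 1 :=
  ((G.summable_alpha b x).tsum_le_tsum (G.prod_coeff_le b x) (summable_geometric_two' 1)).trans_eq
    (tsum_geometric_two' 1)

/-- Only the positions that hold `b` contribute to the series. Prepending a letter `a` multiplies
each of these terms by `coeff a b b`, and adds a new term, namely `1 / 2`, only for `a = b`. -/
theorem alpha_wordCons_self (b : A) (x : BaireSpace A) :
    G.alpha b (wordCons b x) = 1 / 2 + 1 / 2 * G.alpha b x := by
  unfold alpha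
  rw [(G.summable_alpha b _).tsum_eq_zero_add]
  congr 1
  · simpa [wordCons] using G.coeff_of_edge (G.loop_mem b)
  · rw [← tsum_mul_left]
    refine tsum_congr fun i => ?_
    rw [Finset.prod_range_succ']
    simp only [wordCons]
    by_cases h : x i = b
    · rw [h, G.coeff_of_edge (G.loop_mem b), mul_comm]
    · simp [G.coeff_of_ne h]

theorem alpha_wordCons_of_ne {a b : A} (h : a ≠ b) (x : BaireSpace A) :
    G.alpha b (wordCons a x) = G.coeff a b b * G.alpha b x := by
  unfold alpha
  rw [(G.summable_alpha b _).tsum_eq_zero_add, ← tsum_mul_left]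
  have h0 : ∏ j ∈ Finset.range (0 + 1), G.coeff (wordCons a x j) (wordCons a x 0) b = 0 := by
    simp [wordCons, G.coeff_of_ne h]
  rw [h0, zero_add]
  refine tsum_congr fun i => ?_
  rw [Finset.prod_range_succ']
  simp only [wordCons]
  by_cases h : x i = b
  · rw [h, mul_comm]
  · simp [G.coeff_of_ne h]

/-- A constant word is fixed by prepending its letter, so its coordinates are the fixed points of
the affine maps. -/
theorem alpha_wordConst_self (b : A) : G.alpha b (wordConst b) = 1 := by
  have := G.alpha_wordCons_self b (wordConst b)
  rw [← wordConst_eq] at this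
  linarith

theorem alpha_wordConst_of_ne {a b : A} (h : a ≠ b) : G.alpha b (wordConst a) = 0 := by
  have h1 := G.alpha_wordCons_of_ne h (wordConst a)
  rw [← wordConst_eq] at h1
  have h2 := G.coeff_self_le a b
  nlinarith [G.alpha_nonneg b (wordConst a)]

theorem abs_alpha_wordCons_sub (a b : A) (x y : BaireSpace A) :
    |G.alpha b (wordCons a x) - G.alpha b (wordCons a y)| ≤
      1 / 2 * |G.alpha b x - G.alpha b y| := by
  by_cases h : a = b
  · subst h
    rw [alpha_wordCons_self, alpha_wordCons_self, add_sub_add_left_eq_sub, ← mul_sub, abs_mul]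
    norm_num
  · rw [G.alpha_wordCons_of_ne h, G.alpha_wordCons_of_ne h, ← mul_sub, abs_mul,
      abs_of_nonneg (G.coeff_self_nonneg a b)]
    exact mul_le_mul_of_nonneg_right (G.coeff_self_le a b) (abs_nonneg _)

theorem abs_alpha_wordAppend_sub (s : List A) (b : A) (x y : BaireSpace A) :
    |G.alpha b (wordAppend s x) - G.alpha b (wordAppend s y)| ≤ (1 / 2) ^ s.length := by
  induction s with
  | nil =>
    simp only [wordAppend, List.length_nil, pow_zero]
    rw [abs_le]
    have := G.alpha_nonneg b x
    have := G.alpha_nonneg b y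
    have := G.alpha_le_one b x
    have := G.alpha_le_one b y
    constructor <;> linarith
  | cons a s ih =>
    refine (G.abs_alpha_wordCons_sub a b _ _).trans ?_
    rw [List.length_cons, pow_succ']
    gcongr

theorem alpha_wordCons_congr (a : A) {b : A} {x y : BaireSpace A} (h : G.alpha b x = G.alpha b y) :
    G.alpha b (wordCons a x) = G.alpha b (wordCons a y) := by
  by_cases hab : a = b
  · subst hab; rw [alpha_wordCons_self, alpha_wordCons_self, h]
  · rw [G.alpha_wordCons_of_ne hab, G.alpha_wordCons_of_ne hab, h]

theorem alpha_of_wordCons (a : A) {b : A} {x y : BaireSpace A}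
    (h : G.alpha b (wordCons a x) = G.alpha b (wordCons a y)) : G.alpha b x = G.alpha b y := by
  by_cases hab : a = b
  · subst hab; rw [alpha_wordCons_self, alpha_wordCons_self] at h; linarith
  · rw [G.alpha_wordCons_of_ne hab, G.alpha_wordCons_of_ne hab] at h
    exact mul_left_cancel₀ (G.coeff_self_pos a b).ne' h

theorem alpha_wordAppend_congr (s : List A) {b : A} {x y : BaireSpace A} :
    G.alpha b (wordAppend s x) = G.alpha b (wordAppend s y) ↔ G.alpha b x = G.alpha b y := by
  induction s with
  | nil => rfl
  | cons a s ih =>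
    exact ⟨fun h => ih.1 (G.alpha_of_wordCons a h), fun h => G.alpha_wordCons_congr a (ih.2 h)⟩

theorem ne_of_alpha_eq_zero {b : A} {x : BaireSpace A} (h : G.alpha b x = 0) (n : ℕ) :
    x n ≠ b := by
  induction n generalizing x with
  | zero =>
    obtain ⟨a, x, rfl⟩ := exists_eq_wordCons x
    rintro (rfl : a = b)
    rw [alpha_wordCons_self] at h
    linarith [G.alpha_nonneg a x]
  | succ n ih =>
    obtain ⟨a, x, rfl⟩ := exists_eq_wordCons x
    refine ih (x := x) ?_
    by_cases hab : a = b
    · subst hab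
      rw [alpha_wordCons_self] at h
      linarith [G.alpha_nonneg a x]
    · rw [G.alpha_wordCons_of_ne hab] at h
      exact (mul_eq_zero.1 h).resolve_left (G.coeff_self_pos a b).ne'

theorem alpha_wordCons_le_half {a b : A} (h : a ≠ b) (x : BaireSpace A) :
    G.alpha b (wordCons a x) ≤ 1 / 2 := by
  rw [G.alpha_wordCons_of_ne h]
  nlinarith [G.coeff_self_le a b, G.coeff_self_nonneg a b, G.alpha_le_one b x, G.alpha_nonneg b x]

theorem eq_wordConst_of_alpha_eq_one {b : A} {x : BaireSpace A} (h : G.alpha b x = 1) :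
    x = wordConst b := by
  funext n
  induction n generalizing x with
  | zero =>
    obtain ⟨a, x, rfl⟩ := exists_eq_wordCons x
    by_contra hab
    linarith [G.alpha_wordCons_le_half (a := a) (b := b) hab x]
  | succ n ih =>
    obtain ⟨a, x, rfl⟩ := exists_eq_wordCons x
    refine ih (x := x) ?_
    by_cases hab : a = b
    · subst hab
      rw [alpha_wordCons_self] at h
      linarith
    · linarith [G.alpha_wordCons_le_half hab x]

/-- If the words `a x` and `b y` with `a ≠ b` have the same `b`-th coordinate, then `{a, b}` is an
edge, `x = b b b ⋯`, and `y` does not contain `b`. -/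
theorem of_alpha_wordCons_eq {a b : A} (hab : a ≠ b) {x y : BaireSpace A}
    (h : G.alpha b (wordCons a x) = G.alpha b (wordCons b y)) :
    s(a, b) ∈ G.edges ∧ x = wordConst b ∧ G.alpha b y = 0 := by
  rw [alpha_wordCons_self, G.alpha_wordCons_of_ne hab] at h
  have h1 := G.alpha_nonneg b y
  have h2 := G.alpha_le_one b x
  have h3 := G.alpha_nonneg b x
  by_cases he : s(a, b) ∈ G.edges
  · rw [G.coeff_of_edge he] at h
    exact ⟨he, G.eq_wordConst_of_alpha_eq_one (by linarith), by linarith⟩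
  -- Without an edge the coordinate of `a x` is at most `1 / 3`, while that of `b y` is at least `1
  -- / 2`. With an edge both bounds are `1 / 2`, which forces the extreme values.
  · rw [G.coeff_of_not_edge he] at h
    linarith

/-- For `a ≠ b` both words have the coordinates `1 / 2` at `a` and at `b`, and `0` elsewhere. -/
theorem alpha_wordCons_wordConst {a b : A} (h : s(a, b) ∈ G.edges) (c : A) :
    G.alpha c (wordCons a (wordConst b)) = G.alpha c (wordCons b (wordConst a)) := by
  by_cases hab : a = b
  · subst hab; rfl
  by_cases hac : a = c
  · subst hac
    rw [alpha_wordCons_self, G.alpha_wordCons_of_ne (Ne.symm hab), alpha_wordConst_self,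
      G.alpha_wordConst_of_ne (Ne.symm hab), G.coeff_of_edge (Sym2.eq_swap ▸ h)]
    norm_num
  by_cases hbc : b = c
  · subst hbc
    rw [alpha_wordCons_self, G.alpha_wordCons_of_ne hab, alpha_wordConst_self,
      G.alpha_wordConst_of_ne hab, G.coeff_of_edge h]
    norm_num
  · rw [G.alpha_wordCons_of_ne hac, G.alpha_wordCons_of_ne hbc, G.alpha_wordConst_of_ne hac,
      G.alpha_wordConst_of_ne hbc, mul_zero, mul_zero]

theorem Rel.alpha_eq {G : LoopGraph A} {x y : BaireSpace A} (h : G.Rel x y) (b : A) :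
    G.alpha b x = G.alpha b y := by
  rcases h with rfl | ⟨s, a, c, hac, rfl, rfl⟩
  · rfl
  · rw [tailWord_eq, tailWord_eq, alpha_wordAppend_congr]
    exact G.alpha_wordCons_wordConst hac b

theorem eq_wordConst_of_forall_alpha {b z : A} {x : BaireSpace A}
    (h : ∀ c, c ≠ z → c ≠ b → G.alpha c x = 0) (hb : G.alpha b x = 0) : x = wordConst z := by
  funext n
  by_contra hn
  by_cases hxb : x n = b
  · exact G.ne_of_alpha_eq_zero hb n hxb
  · exact G.ne_of_alpha_eq_zero (h _ hn hxb) n rfl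

/-- After removal of the common prefix the first letters `a ≠ b` are not both `z`. A coordinate at
`a` or `b` other than `z` fixes one tail by `of_alpha_wordCons_eq`; if the other letter is `z`, the
remaining coordinates fix the other tail. -/
theorem rel_iff_forall_alpha (z : A) {x y : BaireSpace A} :
    G.Rel x y ↔ ∀ b, b ≠ z → G.alpha b x = G.alpha b y := by
  refine ⟨fun h b _ => h.alpha_eq b, fun h => ?_⟩
  by_cases hxy : x = y
  · exact Or.inl hxy
  obtain ⟨s, a, b, x, y, hab, rfl, rfl⟩ := exists_common_prefix hxy
  simp only [alpha_wordAppend_congr] at h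
  right
  suffices hs : s(a, b) ∈ G.edges ∧ x = wordConst b ∧ y = wordConst a by
    obtain ⟨he, rfl, rfl⟩ := hs
    exact ⟨s, a, b, he, (tailWord_eq s a b).symm, (tailWord_eq s b a).symm⟩
  -- There is no coordinate at `a = z` to use. Instead, `a x` turns out to be `a b b b ⋯`, whose
  -- coordinates other than `a` and `b` vanish; so `y` contains no letter but `z`.
  have key : ∀ {a b : A} {x y : BaireSpace A}, a ≠ b → b ≠ z →
      (∀ c, c ≠ z → G.alpha c (wordCons a x) = G.alpha c (wordCons b y)) → a = z →
      y = wordConst a := by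
    intro a b x y hab hbz h haz
    obtain ⟨-, rfl, h0⟩ := G.of_alpha_wordCons_eq hab (h b hbz)
    rw [haz]
    refine G.eq_wordConst_of_forall_alpha (fun c hcz hcb => ?_) h0
    have := h c hcz
    rw [G.alpha_wordCons_of_ne (haz ▸ hcz.symm), G.alpha_wordCons_of_ne hcb.symm,
      G.alpha_wordConst_of_ne hcb.symm, mul_zero] at this
    exact (mul_eq_zero.1 this.symm).resolve_left (G.coeff_self_pos b c).ne'
  by_cases hbz : b = z
  · have haz : a ≠ z := fun h' => hab (h'.trans hbz.symm)
    obtain ⟨he, rfl, -⟩ := G.of_alpha_wordCons_eq hab.symm (h a haz).symm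
    exact ⟨Sym2.eq_swap ▸ he, key hab.symm haz (fun c hc => (h c hc).symm) hbz, rfl⟩
  · obtain ⟨he, rfl, -⟩ := G.of_alpha_wordCons_eq hab (h b hbz)
    refine ⟨he, rfl, ?_⟩
    by_cases haz : a = z
    · exact key hab hbz h haz
    · exact (G.of_alpha_wordCons_eq hab.symm (h a haz).symm).2.1

theorem continuous_alpha (b : A) : Continuous (G.alpha b) := by
  refine continuous_tsum (u := fun i : ℕ => (1 : ℝ) / 2 / 2 ^ i) (fun i => ?_)
    (summable_geometric_two' 1) (fun i x => ?_)
  · refine BaireSpace.continuous_of_eq (i + 1) fun x y h => ?_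
    refine Finset.prod_congr rfl fun j hj => ?_
    rw [h j (Finset.mem_range.1 hj), h i (Nat.lt_succ_self i)]
  · rw [Real.norm_of_nonneg (G.prod_coeff_nonneg b x i)]
    exact G.prod_coeff_le b x i

/-- For finitely many coordinates `lp` is isometric to `PiLp`, where continuity is checked
coordinatewise. -/
theorem continuous_embed [Finite A] (z : A) : Continuous (G.embed z) := by
  have := Fintype.ofFinite A
  classical
  have h : Continuous fun x => lpPiLpₗᵢ (p := 2) (fun _ : {b : A // b ≠ z} => ℝ) ℝ (G.embed z x) :=
    (PiLp.continuous_toLp 2 _).comp (continuous_pi fun b => G.continuous_alpha b)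
  exact ((lpPiLpₗᵢ (p := 2) (fun _ : {b : A // b ≠ z} => ℝ) ℝ).symm.continuous.comp h).congr
    fun x => LinearIsometryEquiv.symm_apply_apply _ _

theorem embed_eq_iff [Finite A] (z : A) {x y : BaireSpace A} :
    G.embed z x = G.embed z y ↔ G.Rel x y := by
  rw [G.rel_iff_forall_alpha z]
  refine ⟨fun h b hb => congrFun (congrArg Subtype.val h) ⟨b, hb⟩, fun h => ?_⟩
  exact Subtype.ext (funext fun b => h b.1 b.2)

/-! ### The quotient space -/

/-- The map from the quotient space to `ℓ²` induced by `G.embed z`. -/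
noncomputable def lipscombEmbed [Finite A] (z : A) :
    G.Lipscomb → lp (fun _ : {b : A // b ≠ z} => ℝ) 2 :=
  Quotient.lift (G.embed z) fun _ _ h => (G.embed_eq_iff z).2 h

theorem continuous_lipscombEmbed [Finite A] (z : A) : Continuous (G.lipscombEmbed z) :=
  (G.continuous_embed z).quotient_lift _

theorem lipscombEmbed_injective [Finite A] (z : A) : Function.Injective (G.lipscombEmbed z) := by
  rintro ⟨x⟩ ⟨y⟩ h
  exact Quotient.sound ((G.embed_eq_iff z).1 h)

instance instT2Space [Finite A] : T2Space G.Lipscomb := by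
  rcases isEmpty_or_nonempty A with h | ⟨⟨z⟩⟩
  · refine ⟨fun x => ?_⟩
    obtain ⟨x⟩ := x
    exact h.elim (x 0)
  · exact T2Space.of_injective_continuous (G.lipscombEmbed_injective z)
      (G.continuous_lipscombEmbed z)

/-- The quotient space is homeomorphic to its embedded version. -/
noncomputable def lipscombHomeomorph [Finite A] (z : A) : G.Lipscomb ≃ₜ G.omega z :=
  have hr : Set.range (G.lipscombEmbed z) = G.omega z := by
    ext p
    constructor
    · rintro ⟨⟨x⟩, rfl⟩; exact ⟨x, rfl⟩
    · rintro ⟨x, rfl⟩; exact ⟨⟦x⟧, rfl⟩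
  ((G.continuous_lipscombEmbed z).isClosedEmbedding
    (G.lipscombEmbed_injective z)).isEmbedding.toHomeomorph.trans (Homeomorph.setCongr hr)

end LoopGraph

end GraphLipscomb

namespace GraphLipscomb

variable {A : Type*}

namespace LoopGraph

variable (G : LoopGraph A)

/-! ### Cells of the quotient space -/

/-- Form without a distinguished letter: any letter may play the role of `z`, and the word `x`
supplies one. -/
theorem rel_iff_forall_alpha_eq {x y : BaireSpace A} :
    G.Rel x y ↔ ∀ b, G.alpha b x = G.alpha b y :=
  ⟨fun h => h.alpha_eq, fun h => (G.rel_iff_forall_alpha (x 0)).2 fun b _ => h b⟩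

theorem mk_eq_mk {x y : BaireSpace A} :
    (Quotient.mk G.setoid x) = Quotient.mk G.setoid y ↔ ∀ b, G.alpha b x = G.alpha b y :=
  Quotient.eq.trans G.rel_iff_forall_alpha_eq

/-- Prepending a finite word, as a self-map of the quotient space. -/
def lipscombAppend (s : List A) : G.Lipscomb → G.Lipscomb :=
  Quotient.map (wordAppend s) fun _ _ h => G.rel_iff_forall_alpha_eq.2 fun b =>
    (G.alpha_wordAppend_congr s).2 (h.alpha_eq b)

/-- Prepending a letter, as a self-map of the quotient space. -/
abbrev lipscombCons (a : A) : G.Lipscomb → G.Lipscomb := G.lipscombAppend [a]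

/-- The class of the constant word `a a a ⋯`. -/
def vertex (a : A) : G.Lipscomb := Quotient.mk G.setoid (wordConst a)

/-- The cell of all classes of words with prefix `s`. -/
def cell (s : List A) : Set G.Lipscomb := Set.range (G.lipscombAppend s)

theorem continuous_lipscombAppend (s : List A) : Continuous (G.lipscombAppend s) := by
  refine Continuous.quotient_map' ?_ _
  induction s with
  | nil => exact continuous_id
  | cons a s ih => exact (continuous_wordCons a).comp ih

theorem lipscombAppend_injective (s : List A) : Function.Injective (G.lipscombAppend s) := by
  rintro ⟨x⟩ ⟨y⟩ h
  exact G.mk_eq_mk.2 fun b => (G.alpha_wordAppend_congr s).1 (G.mk_eq_mk.1 h b)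

theorem lipscombAppend_append (s t : List A) (p : G.Lipscomb) :
    G.lipscombAppend (s ++ t) p = G.lipscombAppend s (G.lipscombAppend t p) := by
  obtain ⟨x⟩ := p
  exact congrArg _ (wordAppend_append s t x)

theorem lipscombAppend_nil (p : G.Lipscomb) : G.lipscombAppend [] p = p := by
  obtain ⟨x⟩ := p
  rfl

theorem exists_eq_lipscombAppend (n : ℕ) (p : G.Lipscomb) :
    ∃ s q, s.length = n ∧ p = G.lipscombAppend s q := by
  obtain ⟨x⟩ := p
  obtain ⟨s, y, hs, rfl⟩ := exists_eq_wordAppend n x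
  exact ⟨s, Quotient.mk _ y, hs, rfl⟩

theorem exists_eq_lipscombCons (p : G.Lipscomb) : ∃ a q, p = G.lipscombCons a q := by
  obtain ⟨s, q, hs, rfl⟩ := G.exists_eq_lipscombAppend 1 p
  obtain ⟨a, rfl⟩ := List.length_eq_one_iff.1 hs
  exact ⟨a, q, rfl⟩

theorem cell_append_subset (s t : List A) : G.cell (s ++ t) ⊆ G.cell s := by
  rintro _ ⟨p, rfl⟩
  exact ⟨G.lipscombAppend t p, (G.lipscombAppend_append s t p).symm⟩

theorem isClosed_cell [Finite A] (s : List A) : IsClosed (G.cell s) :=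
  (isCompact_range (G.continuous_lipscombAppend s)).isClosed

theorem lipscombCons_vertex {a b : A} (h : s(a, b) ∈ G.edges) :
    G.lipscombCons a (G.vertex b) = G.lipscombCons b (G.vertex a) :=
  G.mk_eq_mk.2 (G.alpha_wordCons_wordConst h)

/-- The geometry of the first subdivision: two different cells have at most one common point, and
only if their letters are adjacent. -/
theorem of_lipscombCons_eq {a b : A} (hab : a ≠ b) {p q : G.Lipscomb}
    (h : G.lipscombCons a p = G.lipscombCons b q) :
    s(a, b) ∈ G.edges ∧ p = G.vertex b ∧ q = G.vertex a := by
  obtain ⟨x⟩ := p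
  obtain ⟨y⟩ := q
  have h' := G.mk_eq_mk.1 h
  obtain ⟨he, hx, -⟩ := G.of_alpha_wordCons_eq hab (h' b)
  obtain ⟨-, hy, -⟩ := G.of_alpha_wordCons_eq hab.symm (h' a).symm
  exact ⟨he, congrArg _ hx, congrArg _ hy⟩

theorem edge_of_mem_cell {a b : A} {p : G.Lipscomb} (ha : p ∈ G.cell [a]) (hb : p ∈ G.cell [b]) :
    s(a, b) ∈ G.edges := by
  by_cases hab : a = b
  · subst hab; exact G.loop_mem a
  · obtain ⟨q, rfl⟩ := ha
    obtain ⟨r, hr⟩ := hb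
    exact (G.of_lipscombCons_eq hab hr.symm).1

/-- Each coordinate varies by at most `(1 / 2) ^ s.length` on the cell of `s`, and the coordinates
separate points. -/
theorem eq_of_forall_mem_cell {p q : G.Lipscomb}
    (h : ∀ n, ∃ s : List A, n ≤ s.length ∧ p ∈ G.cell s ∧ q ∈ G.cell s) : p = q := by
  obtain ⟨x⟩ := p
  obtain ⟨y⟩ := q
  refine G.mk_eq_mk.2 fun b => eq_of_abs_sub_eq_zero (le_antisymm ?_ (abs_nonneg _))
  refine ge_of_tendsto' (tendsto_pow_atTop_nhds_zero_of_lt_one (r := (1 / 2 : ℝ))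
    (by norm_num) (by norm_num)) fun n => ?_
  obtain ⟨s, hs, ⟨⟨x'⟩, hx⟩, ⟨⟨y'⟩, hy⟩⟩ := h n
  rw [← G.mk_eq_mk.1 hx b, ← G.mk_eq_mk.1 hy b]
  exact (G.abs_alpha_wordAppend_sub s b x' y').trans
    (pow_le_pow_of_le_one (by norm_num) (by norm_num) hs)

/-! ### Connectedness of the graph from connectedness of the quotient space -/

theorem connected_of_preconnectedSpace [PreconnectedSpace G.Lipscomb] : G.Connected := by
  intro v
  let C : Set A := {u | ∃ (n : ℕ) (w : ℕ → A), w 0 = v ∧ w n = u ∧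
    ∀ k < n, s(w k, w (k + 1)) ∈ G.edges}
  have hv : v ∈ C := ⟨0, fun _ => v, rfl, rfl, fun k hk => absurd hk (Nat.not_lt_zero k)⟩
  have hC : ∀ a b, s(a, b) ∈ G.edges → a ∈ C → b ∈ C := by
    rintro a b hab ⟨n, w, h0, hn, hw⟩
    refine ⟨n + 1, fun k => if k ≤ n then w k else b, by simp [h0], by simp, fun k hk => ?_⟩
    rcases Nat.lt_succ_iff_lt_or_eq.1 hk with hk | rfl
    · simpa [hk.le, Nat.succ_le_iff.2 hk] using hw k hk
    · simpa [hn] using hab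
  -- Gluing after a nonempty prefix keeps the first letter; with the empty prefix it exchanges the
  -- ends of an edge.
  have hrel : ∀ x y : BaireSpace A, G.Rel x y → (x 0 ∈ C) = (y 0 ∈ C) := by
    rintro x y (rfl | ⟨s, a, b, hab, rfl, rfl⟩)
    · rfl
    · cases s with
      | nil => exact propext ⟨hC a b hab, hC b a (Sym2.eq_swap ▸ hab)⟩
      | cons c s => rfl
  let f : G.Lipscomb → Prop := Quotient.lift (fun x : BaireSpace A => x 0 ∈ C) hrel
  -- All sets `U` are allowed, not only the open ones of the Sierpiński topology on `Prop`; this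
  -- makes the preimage of `True` clopen.
  have hf : ∀ U : Set Prop, IsOpen (f ⁻¹' U) := by
    intro U
    refine isOpen_coinduced.2 ?_
    refine isOpen_iff_mem_nhds.2 fun x hx => (BaireSpace.nhds_hasBasis x).mem_iff.2
      ⟨1, trivial, fun y hy => ?_⟩
    have : y 0 = x 0 := hy 0 one_pos
    change (y 0 ∈ C) ∈ U
    rw [this]
    exact hx
  have hclopen : IsClopen (f ⁻¹' {True}) := ⟨⟨hf {True}ᶜ⟩, hf {True}⟩
  rcases isClopen_iff.1 hclopen with h | h
  · have : G.vertex v ∈ f ⁻¹' {True} := eq_true hv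
    rw [h] at this
    exact this.elim
  · intro u
    have : G.vertex u ∈ f ⁻¹' {True} := h ▸ Set.mem_univ _
    exact of_eq_true this

/-! ### Local connectedness -/

/-- The union `N p n` of the cells of level `n` through `p` is a neighbourhood, because the finitely
many other cells of that level are closed and miss `p`. It is connected, because each cell is a
continuous image of the whole space and contains `p`. The sets `N p n` decrease to `{p}`, so by
compactness they form a basis. -/
theorem locallyConnectedSpace_lipscomb [Finite A] [ConnectedSpace G.Lipscomb] :
    LocallyConnectedSpace G.Lipscomb := by
  let N : G.Lipscomb → ℕ → Set G.Lipscomb := fun p n =>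
    ⋃ s ∈ {s : List A | s.length = n ∧ p ∈ G.cell s}, G.cell s
  have hfin : ∀ n, {s : List A | s.length = n}.Finite := fun n => List.finite_length_eq A n
  have hclosed : ∀ p n, IsClosed (N p n) := fun p n =>
    ((hfin n).subset fun s hs => hs.1).isClosed_biUnion fun s _ => G.isClosed_cell s
  have hnhds : ∀ p n, N p n ∈ 𝓝 p := by
    intro p n
    have hM : IsClosed (⋃ s ∈ {s : List A | s.length = n ∧ p ∉ G.cell s}, G.cell s) :=
      ((hfin n).subset fun s hs => hs.1).isClosed_biUnion fun s _ => G.isClosed_cell s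
    refine mem_of_superset (hM.isOpen_compl.mem_nhds ?_) fun q hq => ?_
    · simp
    · obtain ⟨s, q, hs, rfl⟩ := G.exists_eq_lipscombAppend n q
      by_cases hp : p ∈ G.cell s
      · exact Set.mem_biUnion (show s ∈ {s : List A | s.length = n ∧ p ∈ G.cell s} from ⟨hs, hp⟩)
          ⟨q, rfl⟩
      · refine absurd (Set.mem_biUnion (t := G.cell)
          (show s ∈ {s : List A | s.length = n ∧ p ∉ G.cell s} from ⟨hs, hp⟩) ⟨q, rfl⟩) hq
  have hanti : ∀ p, Antitone (N p) := by
    refine fun p => antitone_nat_of_succ_le fun n => ?_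
    refine Set.iUnion₂_subset fun s hs => ?_
    have hs' : s.take n ++ s.drop n = s := List.take_append_drop n s
    have hsub : G.cell s ⊆ G.cell (s.take n) := by
      conv_lhs => rw [← hs']
      exact G.cell_append_subset _ _
    exact hsub.trans (Set.subset_biUnion_of_mem (u := G.cell)
      (show s.take n ∈ {s : List A | s.length = n ∧ p ∈ G.cell s} from
        ⟨by simp [hs.1], hsub hs.2⟩))
  refine locallyConnectedSpace_of_connected_bases N (fun _ _ => True) (fun p => ⟨fun U => ?_⟩)
    fun p n _ => ?_
  · refine ⟨fun hU => ?_, fun ⟨n, _, hn⟩ => mem_of_superset (hnhds p n) hn⟩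
    obtain ⟨n, hn⟩ := exists_subset_nhds_of_compactSpace (hanti p).directed_ge
      (hclosed p) (U := U) fun q hq => by
      have : p = q := G.eq_of_forall_mem_cell fun n => by
        obtain ⟨s, hs, hq⟩ := Set.mem_iUnion₂.1 (Set.mem_iInter.1 hq n)
        exact ⟨s, hs.1.ge, hs.2, hq⟩
      exact this ▸ hU
    exact ⟨n, trivial, hn⟩
  · refine isPreconnected_of_forall p fun q hq => ?_
    obtain ⟨s, hs, hq⟩ := Set.mem_iUnion₂.1 hq
    exact ⟨G.cell s, Set.subset_biUnion_of_mem (u := G.cell) hs, hs.2, hq,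
      isPreconnected_range (G.continuous_lipscombAppend s)⟩

end LoopGraph

/-! ### Arcwise connectedness implies connectedness; invariance under homeomorphisms. -/

theorem ArcwiseConnected.preconnectedSpace {X : Type*} [TopologicalSpace X]
    (h : ArcwiseConnected X) : PreconnectedSpace X := by
  refine ⟨isPreconnected_of_forall_pair fun x _ y _ => ?_⟩
  by_cases hxy : x = y
  · subst hxy
    exact ⟨{x}, Set.subset_univ _, rfl, rfl, isPreconnected_singleton⟩
  · obtain ⟨f, hf, rfl, rfl⟩ := h x y hxy
    exact ⟨Set.range f, Set.subset_univ _, ⟨0, rfl⟩, ⟨1, rfl⟩, isPreconnected_range hf.continuous⟩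

theorem ArcwiseConnected.of_homeomorph {X Y : Type*} [TopologicalSpace X] [TopologicalSpace Y]
    (e : X ≃ₜ Y) (h : ArcwiseConnected X) : ArcwiseConnected Y := by
  intro x y hxy
  obtain ⟨f, hf, h0, h1⟩ := h (e.symm x) (e.symm y) (e.symm.injective.ne hxy)
  exact ⟨e ∘ f, e.isEmbedding.comp hf, by simp [h0], by simp [h1]⟩

theorem connectedSpace_locallyConnectedSpace_of_homeomorph {X Y : Type*} [TopologicalSpace X]
    [TopologicalSpace Y] (e : X ≃ₜ Y) (h : ConnectedSpace X ∧ LocallyConnectedSpace X) :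
    ConnectedSpace Y ∧ LocallyConnectedSpace Y := by
  obtain ⟨h1, h2⟩ := h
  exact ⟨e.surjective.connectedSpace e.continuous,
    e.symm.isOpenEmbedding.locallyConnectedSpace⟩

end GraphLipscomb

namespace GraphLipscomb

/-! ### The unit interval as a quotient of the binary words -/

/-- The complete graph on two vertices. -/
def boolGraph : LoopGraph Bool := ⟨Set.univ, fun _ => Set.mem_univ _⟩

/-- Here `alpha true` is the value of a binary expansion. Choosing digits one by one approximates
`t`, and the range is closed by compactness. -/
theorem exists_boolGraph_alpha_eq {t : ℝ} (h0 : 0 ≤ t) (h1 : t ≤ 1) :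
    ∃ x, boolGraph.alpha true x = t := by
  have hc : boolGraph.coeff false true true = 1 / 2 := boolGraph.coeff_of_edge (Set.mem_univ _)
  have key : ∀ n : ℕ, ∀ t : ℝ, 0 ≤ t → t ≤ 1 → ∃ x, |boolGraph.alpha true x - t| ≤ (1 / 2) ^ n := by
    intro n
    induction n with
    | zero =>
      intro t h0 h1
      refine ⟨wordConst true, ?_⟩
      rw [LoopGraph.alpha_wordConst_self, abs_le]
      constructor <;> norm_num <;> linarith
    | succ n ih =>
      intro t h0 h1
      rcases le_total t (1 / 2) with h | h
      · obtain ⟨x, hx⟩ := ih (2 * t) (by linarith) (by linarith)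
        refine ⟨wordCons false x, ?_⟩
        rw [boolGraph.alpha_wordCons_of_ne (by simp), hc, pow_succ']
        rw [abs_le] at hx ⊢
        constructor <;> linarith
      · obtain ⟨x, hx⟩ := ih (2 * t - 1) (by linarith) (by linarith)
        refine ⟨wordCons true x, ?_⟩
        rw [boolGraph.alpha_wordCons_self, pow_succ']
        rw [abs_le] at hx ⊢
        constructor <;> linarith
  have hcl : IsClosed (Set.range (boolGraph.alpha true)) :=
    (isCompact_range (boolGraph.continuous_alpha true)).isClosed
  refine hcl.closure_subset (Metric.mem_closure_iff.2 fun ε hε => ?_)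
  obtain ⟨n, hn⟩ := exists_pow_lt_of_lt_one hε (by norm_num : (1 / 2 : ℝ) < 1)
  obtain ⟨x, hx⟩ := key n t h0 h1
  exact ⟨_, ⟨x, rfl⟩, by rw [dist_comm, Real.dist_eq]; linarith⟩

/-- The value in the unit interval of a binary expansion. -/
noncomputable def binaryValue (x : BaireSpace Bool) : unitInterval :=
  ⟨boolGraph.alpha true x, boolGraph.alpha_nonneg true x, boolGraph.alpha_le_one true x⟩

theorem continuous_binaryValue : Continuous binaryValue :=
  (boolGraph.continuous_alpha true).subtype_mk _

theorem binaryValue_surjective : Function.Surjective binaryValue := fun t => by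
  obtain ⟨x, hx⟩ := exists_boolGraph_alpha_eq t.2.1 t.2.2
  exact ⟨x, Subtype.ext hx⟩

theorem binaryValue_eq_iff {x y : BaireSpace Bool} :
    binaryValue x = binaryValue y ↔ boolGraph.Rel x y := by
  rw [boolGraph.rel_iff_forall_alpha false]
  simp [binaryValue, Subtype.ext_iff]

theorem binaryValue_wordConst_false : binaryValue (wordConst false) = 0 :=
  Subtype.ext (boolGraph.alpha_wordConst_of_ne (by simp))

theorem binaryValue_wordConst_true : binaryValue (wordConst true) = 1 :=
  Subtype.ext (boolGraph.alpha_wordConst_self true)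

/-- `binaryValue` is a quotient map whose fibres are the classes of `boolGraph.Rel`. So `f` descends
to a continuous injection of the compact interval into a Hausdorff space. -/
theorem exists_arc_of_rel_iff {X : Type*} [TopologicalSpace X] [T2Space X]
    {f : BaireSpace Bool → X} (hf : Continuous f) (h : ∀ x y, f x = f y ↔ boolGraph.Rel x y) :
    ∃ g : unitInterval → X, IsEmbedding g ∧ g 0 = f (wordConst false) ∧
      g 1 = f (wordConst true) := by
  have hq : IsQuotientMap binaryValue :=
    continuous_binaryValue.isClosedMap.isQuotientMap continuous_binaryValue binaryValue_surjective
  choose inv hinv using binaryValue_surjective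
  have hg : ∀ x, f (inv (binaryValue x)) = f x := fun x =>
    (h _ _).2 (binaryValue_eq_iff.1 (hinv _))
  have hcont : Continuous fun t => f (inv t) := by
    rw [hq.continuous_iff]
    exact hf.congr fun x => (hg x).symm
  refine ⟨fun t => f (inv t), (hcont.isClosedEmbedding fun s t hst => ?_).isEmbedding, ?_, ?_⟩
  · rw [← hinv s, ← hinv t]
    exact binaryValue_eq_iff.2 ((h _ _).1 hst)
  · rw [← binaryValue_wordConst_false]; exact hg _
  · rw [← binaryValue_wordConst_true]; exact hg _

/-! ### Arcs from binary subdivision -/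

/-- A system of pieces of a space that split into two pieces with one common point, in such a way
that infinitely repeated splitting shrinks every piece to a point. -/
structure ArcSystem (S X : Type*) [TopologicalSpace X] where
  /-- the first (`false`) and the second (`true`) part of a piece -/
  step : Bool → S → S
  /-- the initial point of a piece -/
  src : S → X
  /-- the final point of a piece -/
  tgt : S → X
  /-- the set of points of a piece -/
  carrier : S → Set X
  isClosed_carrier : ∀ s, IsClosed (carrier s)
  src_mem : ∀ s, src s ∈ carrier s
  tgt_mem : ∀ s, tgt s ∈ carrier s
  src_ne_tgt : ∀ s, src s ≠ tgt s
  carrier_step : ∀ b s, carrier (step b s) ⊆ carrier s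
  src_step : ∀ s, src (step false s) = src s
  tgt_step : ∀ s, tgt (step true s) = tgt s
  tgt_eq_src : ∀ s, tgt (step false s) = src (step true s)
  inter_subset : ∀ s, carrier (step false s) ∩ carrier (step true s) ⊆ {src (step true s)}
  -- No rate of shrinking is demanded, so no metric is needed; compactness of the space supplies the
  -- uniformity.
  subsingleton : ∀ u : ℕ → S, (∀ n, ∃ b, u (n + 1) = step b (u n)) →
    (⋂ n, carrier (u n)).Subsingleton

namespace ArcSystem

variable {S X : Type*} [TopologicalSpace X] (P : ArcSystem S X)

/-- The piece obtained from `s` by the first `n` choices of the binary word `u`. -/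
def iter (s : S) (u : BaireSpace Bool) : ℕ → S
  | 0 => s
  | n + 1 => P.step (u n) (iter s u n)

theorem iter_wordCons (s : S) (b : Bool) (u : BaireSpace Bool) (n : ℕ) :
    P.iter s (wordCons b u) (n + 1) = P.iter (P.step b s) u n := by
  induction n with
  | zero => rfl
  | succ n ih => exact congrArg (P.step (u n)) ih

theorem iter_congr (s : S) {u v : BaireSpace Bool} (n : ℕ) (h : ∀ i < n, u i = v i) :
    P.iter s u n = P.iter s v n := by
  induction n with
  | zero => rfl
  | succ n ih => simp only [iter, h n n.lt_succ_self, ih fun i hi => h i (hi.trans n.lt_succ_self)]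

theorem antitone_carrier_iter (s : S) (u : BaireSpace Bool) :
    Antitone fun n => P.carrier (P.iter s u n) :=
  antitone_nat_of_succ_le fun _ => P.carrier_step _ _

theorem subsingleton_iter (s : S) (u : BaireSpace Bool) :
    (⋂ n, P.carrier (P.iter s u n)).Subsingleton :=
  P.subsingleton _ fun n => ⟨u n, rfl⟩

/-- Otherwise the initial point would be the common point of the two parts, and the first part would
start and end there. -/
theorem src_notMem (s : S) : P.src s ∉ P.carrier (P.step true s) := fun h => by
  have h1 := P.inter_subset s ⟨P.src_step s ▸ P.src_mem (P.step false s), h⟩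
  rw [Set.mem_singleton_iff, ← P.src_step, ← P.tgt_eq_src] at h1
  exact P.src_ne_tgt _ h1

theorem tgt_notMem (s : S) : P.tgt s ∉ P.carrier (P.step false s) := fun h => by
  have h1 := P.inter_subset s ⟨h, P.tgt_step s ▸ P.tgt_mem (P.step true s)⟩
  rw [Set.mem_singleton_iff, ← P.tgt_step] at h1
  exact P.src_ne_tgt _ h1.symm

variable [CompactSpace X]

theorem exists_mem_iter (s : S) (u : BaireSpace Bool) :
    ∃ p, ∀ n, p ∈ P.carrier (P.iter s u n) := by
  have := IsCompact.nonempty_iInter_of_sequence_nonempty_isCompact_isClosed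
    (fun n => P.carrier (P.iter s u n)) (fun n => P.antitone_carrier_iter s u n.le_succ)
    (fun n => ⟨_, P.src_mem _⟩) (P.isClosed_carrier _).isCompact fun n => P.isClosed_carrier _
  exact this.imp fun p hp => Set.mem_iInter.1 hp

/-- The point singled out by the infinite word `u` of choices. -/
noncomputable def point (s : S) (u : BaireSpace Bool) : X := (P.exists_mem_iter s u).choose

theorem point_mem (s : S) (u : BaireSpace Bool) (n : ℕ) :
    P.point s u ∈ P.carrier (P.iter s u n) :=
  (P.exists_mem_iter s u).choose_spec n

theorem eq_point {s : S} {u : BaireSpace Bool} {p : X}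
    (h : ∀ n, p ∈ P.carrier (P.iter s u n)) : p = P.point s u :=
  P.subsingleton_iter s u (Set.mem_iInter.2 h) (Set.mem_iInter.2 (P.point_mem s u))

theorem point_wordCons (s : S) (b : Bool) (u : BaireSpace Bool) :
    P.point s (wordCons b u) = P.point (P.step b s) u :=
  P.eq_point fun n => P.iter_wordCons s b u n ▸ P.point_mem s (wordCons b u) (n + 1)

theorem point_wordAppend (l : List Bool) (s : S) :
    ∃ t, ∀ u, P.point s (wordAppend l u) = P.point t u := by
  induction l generalizing s with
  | nil => exact ⟨s, fun u => rfl⟩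
  | cons b l ih =>
    obtain ⟨t, ht⟩ := ih (P.step b s)
    exact ⟨t, fun u => (P.point_wordCons s b _).trans (ht u)⟩

theorem point_mem_carrier (s : S) (u : BaireSpace Bool) : P.point s u ∈ P.carrier s :=
  P.point_mem s u 0

/-- The nested closed pieces along `u` meet only in the point of `u`, so one of them lies in `U`; it
contains the points of all words with the same prefix. -/
theorem continuous_point (s : S) : Continuous (P.point s) := by
  refine BaireSpace.continuous_of_forall fun u U hU => ?_
  obtain ⟨n, hn⟩ := exists_subset_nhds_of_compactSpace (P.antitone_carrier_iter s u).directed_ge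
    (fun n => P.isClosed_carrier _) (U := U) fun q hq =>
      (P.eq_point (Set.mem_iInter.1 hq)) ▸ hU
  exact ⟨n, fun v hv => hn (P.iter_congr s n hv ▸ P.point_mem s v n)⟩

theorem point_false (s : S) : P.point s (wordConst false) = P.src s := by
  refine (P.eq_point fun n => ?_).symm
  have : P.src (P.iter s (wordConst false) n) = P.src s := by
    induction n with
    | zero => rfl
    | succ n ih => exact (P.src_step _).trans ih
  exact this ▸ P.src_mem _

theorem point_true (s : S) : P.point s (wordConst true) = P.tgt s := by
  refine (P.eq_point fun n => ?_).symm
  have : P.tgt (P.iter s (wordConst true) n) = P.tgt s := by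
    induction n with
    | zero => rfl
    | succ n ih => exact (P.tgt_step _).trans ih
  exact this ▸ P.tgt_mem _

/-- The initial point avoids the second part, so the first choice is `false`; it is again the
initial point of the first part, and the argument repeats. -/
theorem eq_false_of_point {s : S} {u : BaireSpace Bool} (h : P.point s u = P.src s) :
    u = wordConst false := by
  have key : ∀ s u, P.point s u = P.src s → ∃ v, u = wordCons false v ∧
      P.point (P.step false s) v = P.src (P.step false s) := by
    intro s u h
    obtain ⟨b, u, rfl⟩ := exists_eq_wordCons u
    rw [P.point_wordCons] at h
    cases b with
    | false => exact ⟨u, rfl, h.trans (P.src_step s).symm⟩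
    | true => exact (P.src_notMem s (h ▸ P.point_mem_carrier _ u)).elim
  funext n
  induction n generalizing s u with
  | zero => obtain ⟨v, rfl, -⟩ := key s u h; rfl
  | succ n ih => obtain ⟨v, rfl, hv⟩ := key s u h; exact ih hv

theorem eq_true_of_point {s : S} {u : BaireSpace Bool} (h : P.point s u = P.tgt s) :
    u = wordConst true := by
  have key : ∀ s u, P.point s u = P.tgt s → ∃ v, u = wordCons true v ∧
      P.point (P.step true s) v = P.tgt (P.step true s) := by
    intro s u h
    obtain ⟨b, u, rfl⟩ := exists_eq_wordCons u
    rw [P.point_wordCons] at h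
    cases b with
    | true => exact ⟨u, rfl, h.trans (P.tgt_step s).symm⟩
    | false => exact (P.tgt_notMem s (h ▸ P.point_mem_carrier _ u)).elim
  funext n
  induction n generalizing s u with
  | zero => obtain ⟨v, rfl, -⟩ := key s u h; rfl
  | succ n ih => obtain ⟨v, rfl, hv⟩ := key s u h; exact ih hv

theorem point_false_true (s : S) : P.point s (wordCons false (wordConst true)) =
    P.point s (wordCons true (wordConst false)) := by
  rw [P.point_wordCons, P.point_wordCons, P.point_true, P.point_false, P.tgt_eq_src]

theorem eq_of_point_eq {s : S} {u v : BaireSpace Bool}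
    (h : P.point s (wordCons false u) = P.point s (wordCons true v)) :
    u = wordConst true ∧ v = wordConst false := by
  rw [P.point_wordCons, P.point_wordCons] at h
  have hm := P.inter_subset s
    ⟨P.point_mem_carrier (P.step false s) u, h ▸ P.point_mem_carrier (P.step true s) v⟩
  rw [Set.mem_singleton_iff] at hm
  exact ⟨P.eq_true_of_point (hm.trans (P.tgt_eq_src s).symm), P.eq_false_of_point (h ▸ hm)⟩

/-- At the first difference the two points lie in the two parts of one piece. They agree only at the
common point, which is the end of the first part and the start of the second and so has the single
codes `true true ⋯` and `false false ⋯` there. -/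
theorem point_eq_point_iff (s : S) (u v : BaireSpace Bool) :
    P.point s u = P.point s v ↔ boolGraph.Rel u v := by
  constructor
  · intro h
    by_cases huv : u = v
    · exact Or.inl huv
    obtain ⟨l, a, b, u, v, hab, rfl, rfl⟩ := exists_common_prefix huv
    obtain ⟨t, ht⟩ := P.point_wordAppend l s
    rw [ht, ht] at h
    refine Or.inr ⟨l, a, b, Set.mem_univ _, ?_⟩
    rw [tailWord_eq, tailWord_eq]
    cases a <;> cases b
    · exact (hab rfl).elim
    · obtain ⟨rfl, rfl⟩ := P.eq_of_point_eq h
      exact ⟨rfl, rfl⟩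
    · obtain ⟨rfl, rfl⟩ := P.eq_of_point_eq h.symm
      exact ⟨rfl, rfl⟩
    · exact (hab rfl).elim
  · rintro (rfl | ⟨l, a, b, -, rfl, rfl⟩)
    · rfl
    · obtain ⟨t, ht⟩ := P.point_wordAppend l s
      rw [tailWord_eq, tailWord_eq, ht, ht]
      cases a <;> cases b
      · rfl
      · exact P.point_false_true t
      · exact (P.point_false_true t).symm
      · rfl

theorem exists_arc [T2Space X] (s : S) :
    ∃ g : unitInterval → X, IsEmbedding g ∧ g 0 = P.src s ∧ g 1 = P.tgt s := by
  rw [← P.point_false, ← P.point_true]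
  exact exists_arc_of_rel_iff (P.continuous_point s) (P.point_eq_point_iff s)

end ArcSystem
end GraphLipscomb

namespace GraphLipscomb

variable {A : Type*}

namespace LoopGraph

variable (G : LoopGraph A)

instance instCompactSpaceLipscomb [Finite A] : CompactSpace G.Lipscomb :=
  inferInstanceAs (CompactSpace (Quotient G.setoid))

/-! ### Chains of cells -/

/-- An induced path `v 0, …, v len` of the graph such that `p` lies in the first of the cells
`v 0, …, v len` only and `q` in the last one only. -/
structure IsChain (len : ℕ) (v : ℕ → A) (p q : G.Lipscomb) : Prop where
  pos : 0 < len
  mem_left : p ∈ G.cell [v 0]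
  notMem_left : ∀ i, 0 < i → i ≤ len → p ∉ G.cell [v i]
  mem_right : q ∈ G.cell [v len]
  notMem_right : ∀ i < len, q ∉ G.cell [v i]
  edge : ∀ i < len, s(v i, v (i + 1)) ∈ G.edges
  -- Loops are edges, so `edge` does not exclude a repeated letter.
  ne : ∀ i < len, v i ≠ v (i + 1)
  not_edge : ∀ i j, i + 1 < j → j ≤ len → s(v i, v j) ∉ G.edges

variable {G}

/-- Take a shortest walk from a cell through `p` to a cell through `q`, over all choices of the end
cells: each violation of a condition would allow a shorter walk. -/
theorem Connected.exists_isChain (hG : G.Connected) {p q : G.Lipscomb}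
    (hpq : ∀ a, p ∈ G.cell [a] → q ∉ G.cell [a]) : ∃ n v, G.IsChain n v p q := by
  classical
  have hex : ∃ (n : ℕ) (w : ℕ → A), p ∈ G.cell [w 0] ∧ q ∈ G.cell [w n] ∧
      ∀ k < n, s(w k, w (k + 1)) ∈ G.edges := by
    obtain ⟨a, p, rfl⟩ := G.exists_eq_lipscombCons p
    obtain ⟨b, q, rfl⟩ := G.exists_eq_lipscombCons q
    obtain ⟨n, w, rfl, rfl, hw⟩ := hG a b
    exact ⟨n, w, ⟨p, rfl⟩, ⟨q, rfl⟩, hw⟩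
  obtain ⟨v, hp, hq, hv⟩ := Nat.find_spec hex
  have hmin : ∀ (m : ℕ) (w : ℕ → A), p ∈ G.cell [w 0] → q ∈ G.cell [w m] →
      (∀ k < m, s(w k, w (k + 1)) ∈ G.edges) → Nat.find hex ≤ m :=
    fun m w h1 h2 h3 => Nat.find_min' hex ⟨w, h1, h2, h3⟩
  generalize Nat.find hex = n at hp hq hv hmin
  have hq' : ∀ i < n, q ∉ G.cell [v i] := fun i hi h =>
    absurd (hmin i v hp h fun k hk => hv k (hk.trans hi)) (not_le.2 hi)
  -- A chord from `v i` would allow the `d` letters after `v i` to be skipped.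
  have hcut : ∀ i d, 0 < d → i + 1 + d ≤ n → s(v i, v (i + 1 + d)) ∉ G.edges := by
    intro i d hd hi he
    refine absurd (hmin (n - d) (fun k => if k ≤ i then v k else v (k + d)) (by simpa using hp) ?_
      fun k hk => ?_) (by omega)
    · rw [if_neg (by omega)]
      rwa [show n - d + d = n by omega]
    · rcases lt_trichotomy k i with h | rfl | h
      · rw [if_pos h.le, if_pos (by omega)]
        exact hv k (by omega)
      · rw [if_pos le_rfl, if_neg (by omega)]
        exact he
      · rw [if_neg (by omega), if_neg (by omega), show k + 1 + d = k + d + 1 by omega]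
        exact hv (k + d) (by omega)
  refine ⟨n, v, Nat.pos_of_ne_zero ?_, hp, fun i h0 hi h => ?_, hq, hq', hv, fun i hi h => ?_,
    fun i j hij hj => ?_⟩
  · rintro rfl
    exact hpq _ hp hq
  · refine absurd (hmin (n - i) (fun k => v (k + i)) (by simpa using h) ?_ fun k hk => ?_)
      (by omega)
    · rwa [show n - i + i = n by omega]
    · rw [show k + 1 + i = k + i + 1 by omega]
      exact hv (k + i) (by omega)
  -- If `v i = v (i + 1)`, the next edge is a chord starting at `v i`; at the end of the walk, `q`
  -- would already lie in an earlier cell.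
  · rcases Nat.lt_or_ge (i + 1) n with h' | h'
    · refine hcut i 1 one_pos h' ?_
      rw [h]
      exact hv (i + 1) h'
    · obtain rfl : n = i + 1 := by omega
      exact hq' i hi (h ▸ hq)
  · obtain ⟨d, rfl⟩ := Nat.exists_eq_add_of_lt hij
    exact hcut i (d + 1) d.succ_pos hj

variable (G) in
/-- A chain of cells inside the cell of a finite word, with two points in its end cells. -/
structure Chain where
  /-- the common prefix of all cells -/
  word : List A
  /-- the number of cells, minus one -/
  len : ℕ
  /-- the path of letters -/
  path : ℕ → A
  /-- the first point, without the common prefix -/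
  left : G.Lipscomb
  /-- the last point, without the common prefix -/
  right : G.Lipscomb
  isChain : G.IsChain len path left right

namespace Chain

/-- The first point of a chain. -/
def src (c : G.Chain) : G.Lipscomb := G.lipscombAppend c.word c.left

/-- The last point of a chain. -/
def tgt (c : G.Chain) : G.Lipscomb := G.lipscombAppend c.word c.right

/-- The union of the cells of a chain. -/
def carrier (c : G.Chain) : Set G.Lipscomb :=
  G.lipscombAppend c.word '' ⋃ i ∈ Finset.range (c.len + 1), G.cell [c.path i]

theorem carrier_subset_cell (c : G.Chain) : c.carrier ⊆ G.cell c.word := Set.image_subset_range _ _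

theorem mem_carrier {c : G.Chain} {i : ℕ} (hi : i ≤ c.len) {p : G.Lipscomb}
    (hp : p ∈ G.cell [c.path i]) : G.lipscombAppend c.word p ∈ c.carrier :=
  ⟨p, Set.mem_biUnion (Finset.mem_range.2 (Nat.lt_succ_of_le hi)) hp, rfl⟩

theorem cell_subset_carrier (c : G.Chain) {i : ℕ} (hi : i ≤ c.len) :
    G.cell (c.word ++ [c.path i]) ⊆ c.carrier := by
  rintro _ ⟨p, rfl⟩
  rw [G.lipscombAppend_append]
  exact mem_carrier hi ⟨p, rfl⟩

theorem src_mem (c : G.Chain) : c.src ∈ c.carrier := mem_carrier (Nat.zero_le _) c.isChain.mem_left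

theorem tgt_mem (c : G.Chain) : c.tgt ∈ c.carrier := mem_carrier le_rfl c.isChain.mem_right

theorem src_ne_tgt (c : G.Chain) : c.src ≠ c.tgt := fun h =>
  c.isChain.notMem_right 0 c.isChain.pos
    (G.lipscombAppend_injective _ h ▸ c.isChain.mem_left)

theorem isClosed_carrier [Finite A] (c : G.Chain) : IsClosed c.carrier :=
  ((isClosed_biUnion_finset fun _ _ => G.isClosed_cell _).isCompact.image
    (G.continuous_lipscombAppend _)).isClosed

end Chain

/-! ### Existence and subdivision of chains. -/

theorem Connected.exists_chain (hG : G.Connected) (w : List A) {p q : G.Lipscomb} (hpq : p ≠ q) :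
    ∃ c : G.Chain, w.length ≤ c.word.length ∧ c.carrier ⊆ G.cell w ∧
      c.src = G.lipscombAppend w p ∧ c.tgt = G.lipscombAppend w q := by
  classical
  have hex : ∃ n, ¬ ∃ s : List A, n ≤ s.length ∧ p ∈ G.cell s ∧ q ∈ G.cell s := by
    by_contra! h
    exact hpq (G.eq_of_forall_mem_cell h)
  have hn := Nat.find_spec hex
  have h0 : Nat.find hex ≠ 0 := fun h => by
    rw [h] at hn
    exact hn ⟨[], le_rfl, ⟨p, G.lipscombAppend_nil p⟩, ⟨q, G.lipscombAppend_nil q⟩⟩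
  -- `s` is a longest prefix whose cell contains both points: after its removal no cell of a single
  -- letter contains both, as `exists_isChain` requires.
  obtain ⟨s, hs, ⟨p, rfl⟩, ⟨q, rfl⟩⟩ := not_not.1 (Nat.find_min hex (Nat.sub_one_lt h0))
  have hcell : ∀ a, p ∈ G.cell [a] → q ∉ G.cell [a] := by
    rintro a ⟨p, rfl⟩ ⟨q, rfl⟩
    refine hn ⟨s ++ [a], ?_, ⟨p, G.lipscombAppend_append _ _ _⟩, ⟨q, G.lipscombAppend_append _ _ _⟩⟩
    rw [List.length_append, List.length_singleton]
    omega
  obtain ⟨n, v, hv⟩ := hG.exists_isChain hcell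
  refine ⟨⟨w ++ s, n, v, p, q, hv⟩, by simp, ?_, G.lipscombAppend_append _ _ _,
    G.lipscombAppend_append _ _ _⟩
  exact (Chain.carrier_subset_cell _).trans (G.cell_append_subset _ _)

/-- The chain is cut at the point `v 0 v 1 v 1 ⋯ = v 1 v 0 v 0 ⋯` where its first two cells meet.
`L` is a new chain inside the first cell, and `R` runs through the other cells. Since the path is
induced, the first cell meets the others only at the cut. The last two conditions are a
lexicographic progress measure: the prefix grows, or it keeps its length and the chain loses cells.
-/
theorem Connected.exists_split (hG : G.Connected) (c : G.Chain) : ∃ L R : G.Chain,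
    L.src = c.src ∧ R.tgt = c.tgt ∧ L.tgt = R.src ∧
    L.carrier ⊆ c.carrier ∧ R.carrier ⊆ c.carrier ∧ L.carrier ∩ R.carrier ⊆ {R.src} ∧
    c.word.length < L.word.length ∧
    (c.word.length < R.word.length ∨ R.word.length = c.word.length ∧ R.len < c.len) := by
  obtain ⟨w, n, v, p, q, h⟩ := c
  have hpos := h.pos
  have he := h.edge 0 hpos
  have hmid := G.lipscombCons_vertex he
  obtain ⟨p, rfl⟩ := id h.mem_left
  have hp : p ≠ G.vertex (v 1) := by
    rintro rfl
    exact h.notMem_left 1 one_pos hpos ⟨G.vertex (v 0), hmid.symm⟩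
  obtain ⟨L, hL1, hL2, hL3, hL4⟩ := hG.exists_chain (w ++ [v 0]) hp
  rw [G.lipscombAppend_append] at hL3 hL4
  suffices hR : ∃ R : G.Chain, R.tgt = G.lipscombAppend w q ∧
      R.src = G.lipscombAppend w (G.lipscombCons (v 1) (G.vertex (v 0))) ∧
      R.carrier ⊆ G.lipscombAppend w '' {x | ∃ i, 0 < i ∧ i ≤ n ∧ x ∈ G.cell [v i]} ∧
      (w.length < R.word.length ∨ R.word.length = w.length ∧ R.len < n) by
    obtain ⟨R, hR1, hR2, hR3, hR4⟩ := hR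
    refine ⟨L, R, hL3, hR1, (hL4.trans (congrArg _ hmid)).trans hR2.symm, ?_, ?_, ?_, ?_, hR4⟩
    · exact hL2.trans (Chain.cell_subset_carrier ⟨w, n, v, _, q, h⟩ (Nat.zero_le _))
    · intro y hy
      obtain ⟨x, ⟨i, -, hi, hx⟩, rfl⟩ := hR3 hy
      exact Chain.mem_carrier (c := ⟨w, n, v, _, q, h⟩) hi hx
    · rintro x ⟨hxL, hxR⟩
      obtain ⟨x, ⟨i, h0, hi, y, rfl⟩, rfl⟩ := hR3 hxR
      obtain ⟨z, hz⟩ := hL2 hxL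
      rw [G.lipscombAppend_append] at hz
      have hz := G.lipscombAppend_injective w hz
      have hedge : s(v 0, v i) ∈ G.edges := G.edge_of_mem_cell ⟨z, rfl⟩ ⟨y, hz.symm⟩
      obtain rfl : i = 1 := by
        by_contra hi1
        exact h.not_edge 0 i (by omega) hi hedge
      obtain ⟨-, -, rfl⟩ := G.of_lipscombCons_eq (h.ne 0 hpos) hz
      exact hR2.symm
    · rw [List.length_append, List.length_singleton] at hL1
      exact hL1
  -- With at least three cells, `R` drops the first one; with two, `R` is a new chain inside the
  -- second cell.
  rcases Nat.lt_or_ge 1 n with hn | hn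
  · have hsub : n - 1 + 1 = n := by omega
    refine ⟨⟨w, n - 1, fun i => v (i + 1), G.lipscombCons (v 1) (G.vertex (v 0)), q, ?_⟩,
      rfl, rfl, ?_, Or.inr ⟨rfl, ?_⟩⟩
    · refine ⟨by omega, ⟨_, rfl⟩, fun i h0 hi hm => ?_, ?_, fun i hi => h.notMem_right _ (by omega),
        fun i hi => h.edge _ (by omega), fun i hi => h.ne _ (by omega),
        fun i j hij hj => h.not_edge _ _ (by omega) (by omega)⟩
      -- The cut also lies in the cell of `v 0`, so a later cell through it would give a chord from
      -- `v 0`.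
      · exact h.not_edge 0 (i + 1) (by omega) (by omega) (G.edge_of_mem_cell ⟨_, hmid⟩ hm)
      · rw [hsub]
        exact h.mem_right
    · refine Set.image_mono (Set.iUnion₂_subset fun i hi x hx => ⟨i + 1, i.succ_pos, ?_, hx⟩)
      have := Finset.mem_range.1 hi
      simp only at this
      omega
    · exact Nat.sub_one_lt hpos.ne'
  · obtain rfl : n = 1 := by omega
    obtain ⟨q, rfl⟩ := id h.mem_right
    have hq : G.vertex (v 0) ≠ q := by
      rintro rfl
      exact h.notMem_right 0 one_pos ⟨_, hmid⟩
    obtain ⟨R, hR1, hR2, hR3, hR4⟩ := hG.exists_chain (w ++ [v 1]) hq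
    rw [G.lipscombAppend_append] at hR3 hR4
    rw [List.length_append, List.length_singleton] at hR1
    refine ⟨R, hR4, hR3, hR2.trans ?_, Or.inl hR1⟩
    rintro _ ⟨x, rfl⟩
    exact ⟨G.lipscombCons (v 1) x, ⟨1, one_pos, le_rfl, ⟨x, rfl⟩⟩,
      (G.lipscombAppend_append _ _ _).symm⟩

theorem Connected.arcwiseConnected [Finite A] (hG : G.Connected) :
    ArcwiseConnected G.Lipscomb := by
  choose L R h1 h2 h3 h4 h5 h6 h7 h8 using hG.exists_split
  have hstep : ∀ (b : Bool) (c : G.Chain), c.word.length < (cond b (R c) (L c)).word.length ∨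
      (cond b (R c) (L c)).word.length = c.word.length ∧ (cond b (R c) (L c)).len < c.len := by
    rintro (_ | _) c
    exacts [Or.inl (h7 c), h8 c]
  let P : ArcSystem G.Chain G.Lipscomb :=
    { step := fun b c => cond b (R c) (L c)
      src := Chain.src
      tgt := Chain.tgt
      carrier := Chain.carrier
      isClosed_carrier := Chain.isClosed_carrier
      src_mem := Chain.src_mem
      tgt_mem := Chain.tgt_mem
      src_ne_tgt := Chain.src_ne_tgt
      carrier_step := by
        rintro (_ | _) c
        exacts [h4 c, h5 c]
      src_step := h1
      tgt_step := h2
      tgt_eq_src := h3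
      inter_subset := h6
      subsingleton := by
        intro u hu p hp q hq
        have hlt : ∀ n, (u n).word.length < (u (n + 1)).word.length ∨
            (u (n + 1)).word.length = (u n).word.length ∧ (u (n + 1)).len < (u n).len := by
          intro n
          obtain ⟨b, hb⟩ := hu n
          rw [hb]
          exact hstep b (u n)
        -- The number of cells can drop only finitely often before the prefix has to grow. So the
        -- prefixes become arbitrarily long, and `eq_of_forall_mem_cell` applies.
        have hgrow : ∀ k n, (u n).len ≤ k → ∃ m, (u n).word.length < (u m).word.length := by
          intro k
          induction k with
          | zero =>
            intro n hn
            exact ⟨n + 1, (hlt n).resolve_right fun h => by omega⟩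
          | succ k ih =>
            intro n hn
            rcases hlt n with h | ⟨h, h'⟩
            · exact ⟨n + 1, h⟩
            · exact h ▸ ih (n + 1) (by omega)
        refine G.eq_of_forall_mem_cell fun N => ?_
        suffices h : ∃ n, N ≤ (u n).word.length by
          obtain ⟨n, hn⟩ := h
          exact ⟨(u n).word, hn, (u n).carrier_subset_cell (Set.mem_iInter.1 hp n),
            (u n).carrier_subset_cell (Set.mem_iInter.1 hq n)⟩
        induction N with
        | zero => exact ⟨0, Nat.zero_le _⟩
        | succ N ih =>
          obtain ⟨n, hn⟩ := ih
          obtain ⟨m, hm⟩ := hgrow _ n le_rfl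
          exact ⟨m, by omega⟩ }
  intro p q hpq
  obtain ⟨c, -, -, hp, hq⟩ := hG.exists_chain [] hpq
  rw [G.lipscombAppend_nil] at hp hq
  rw [← hp, ← hq]
  exact P.exists_arc c

end LoopGraph

end GraphLipscomb

/-! ### The equivalence of the five statements. -/

theorem mainTheorem3 {A : Type*} [Finite A] (G : GraphLipscomb.LoopGraph A) (z : A) :
    List.TFAE [
      G.Connected,
      ConnectedSpace G.Lipscomb ∧ LocallyConnectedSpace G.Lipscomb,
      ConnectedSpace (G.omega z) ∧ LocallyConnectedSpace (G.omega z),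
      GraphLipscomb.ArcwiseConnected G.Lipscomb,
      GraphLipscomb.ArcwiseConnected (G.omega z)] := by
  tfae_have 1 → 4 := fun h => h.arcwiseConnected
  tfae_have 4 → 1 := fun h =>
    have := h.preconnectedSpace
    G.connected_of_preconnectedSpace
  tfae_have 1 → 2 := fun h => by
    have := h.arcwiseConnected.preconnectedSpace
    have : ConnectedSpace G.Lipscomb := { toNonempty := ⟨G.vertex z⟩ }
    exact ⟨this, G.locallyConnectedSpace_lipscomb⟩
  tfae_have 2 → 1 := fun ⟨_, _⟩ => G.connected_of_preconnectedSpace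
  tfae_have 2 → 3 :=
    GraphLipscomb.connectedSpace_locallyConnectedSpace_of_homeomorph (G.lipscombHomeomorph z)
  tfae_have 3 → 2 :=
    GraphLipscomb.connectedSpace_locallyConnectedSpace_of_homeomorph (G.lipscombHomeomorph z).symm
  tfae_have 4 → 5 := fun h => h.of_homeomorph (G.lipscombHomeomorph z)
  tfae_have 5 → 4 := fun h => h.of_homeomorph (G.lipscombHomeomorph z).symm
  tfae_finish
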